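/- Let $n\ge 3$ and let $E\subset\mathbb{R}^n$ be a bounded set with smooth boundary, meaning that near each of its points the topological boundary $\partial E$ is the zero set of a $C^\infty$ function with nonvanishing differential. For $s\in(0,\tfrac12)$ let $$\mathrm{Per}_s(E,\mathbb{R}^n)=\int_E\int_{\mathbb{R}^n\setminus E}\frac{dy\,dx}{|x-y|^{n+2s}}$$ be the $s$-perimeter of $E$ in $\mathbb{R}^n$, let $\varpi_n=\mathcal{H}^{n-1}(S^{n-1})$ be the $(n-1)$-dimensional Hausdorff measure of the unit sphere of $\mathbb{R}^n$ (normalized to agree with Lebesgue measure on $\mathbb{R}^{n-1}$), and let $|E|$ be the Lebesgue measure of $E$. Then $$\lim_{s\searrow0}s\,\mathrm{Per}_s(E,\mathbb{R}^n)=\frac{\varpi_n}{2}\,|E|.$$ -/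

import Mathlib

open MeasureTheory Set Filter Topology
open scoped ENNReal ContDiff

/-- `E ⊆ ℝⁿ` has smooth boundary: the topological boundary of `E` is a smooth embedded hypersurface,
i.e. near each of its points it is the zero set of a `C^∞` function with nonvanishing differential.
Nothing is asked about which points of the boundary belong to `E`, so open sets, closed sets
and sets in between are all allowed. -/
def HasSmoothBoundary {n : ℕ} (E : Set (EuclideanSpace ℝ (Fin n))) : Prop :=
  ∀ p ∈ frontier E, ∃ (U : Set (EuclideanSpace ℝ (Fin n))) (f : EuclideanSpace ℝ (Fin n) → ℝ),
    IsOpen U ∧ p ∈ U ∧ ContDiffOn ℝ ∞ f U ∧ fderiv ℝ f p ≠ 0 ∧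
      frontier E ∩ U = {x | f x = 0} ∩ U

/-- The interaction `I(S₁, S₂) = ∬_{S₁ × S₂} |x - y|^{-(n+2s)} dx dy ∈ [0, ∞]`
of two (disjoint) subsets of `ℝⁿ`. -/
noncomputable def interaction {n : ℕ} (s : ℝ) (S₁ S₂ : Set (EuclideanSpace ℝ (Fin n))) : ℝ≥0∞ :=
  ∫⁻ z in S₁ ×ˢ S₂, ENNReal.ofReal (1 / ‖z.1 - z.2‖ ^ ((n : ℝ) + 2 * s))

/-- The fractional perimeter `Per_s(E, Ω) ∈ [0, ∞]`. -/
noncomputable def fractionalPerimeter {n : ℕ} (s : ℝ) (E Ω : Set (EuclideanSpace ℝ (Fin n))) :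
    ℝ≥0∞ :=
  interaction s (E ∩ Ω) (Eᶜ ∩ Ω) + interaction s (E ∩ Ω) (Eᶜ \ Ω) + interaction s (E \ Ω) (Eᶜ ∩ Ω)

/-- `ϖ_n = ℋ^{n-1}(S^{n-1})` for `n ≥ 1`, with the `(n-1)`-dimensional Hausdorff measure normalized
so as to agree with Lebesgue measure on `ℝ^{n-1}`. -/
noncomputable def sphereArea (n : ℕ) : ℝ≥0∞ :=
  μHE[n - 1] (Metric.sphere (0 : EuclideanSpace ℝ (Fin n)) 1)

/-! Write `c` for `n` times the volume of the unit ball. In polar coordinates, the kernel integrated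
over `R ≤ ‖x - y‖` gives `c * R ^ (-2s) / (2s)`, and `s` times this tends to `c / 2`. So the limit
only sees far interactions. Fix `R ≥ 1` larger than all distances within `E`. For `x ∈ E` the whole
region `R ≤ ‖x - y‖` lies in `Eᶜ`, which gives the lower bound (`le_interaction_compl`). For the
upper bound (`interaction_compl_le`), pairs closer than `R` contribute at most `R` times the
interaction at exponent `1/4`; the factor `s` kills this once it is finite. Finiteness
(`interaction_quarter_lt_top`) is where smoothness enters: with `d` the distance to the boundary,
the inner integral at `x ∈ E` is at most `2c * d(x) ^ (-1/2)`, which is integrable because the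
`t`-neighbourhood of the boundary has volume `O(t)`. It remains to identify `c` with the Hausdorff
measure of the sphere (`euclideanHausdorffMeasure_sphere`), by comparing small spherical caps with
their projections to tangent hyperplanes. -/

/-! ### The area of the unit sphere, by cones over small caps. -/

section Sphere

variable {V : Type*} [NormedAddCommGroup V] [InnerProductSpace ℝ V]

/-- The part at height less than `h` of the cone with apex `0` over a subset `F` of the affine
hyperplane `⟪x, z⟫ = 1`. -/
def flatCone (x : V) (h : ℝ) (F : Set V) : Set V :=
  {w | 0 < inner ℝ x w ∧ inner ℝ x w < h ∧ (inner ℝ x w)⁻¹ • w ∈ F}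

/-- The punctured cone of height `1` over a subset of the unit sphere. -/
def sphericalCone (A : Set V) : Set V :=
  {w | w ≠ 0 ∧ ‖w‖ < 1 ∧ ‖w‖⁻¹ • w ∈ A}

/-- The central projection of a subset of the sphere to the hyperplane `⟪x, z⟫ = 1`. -/
def centralProjection (x : V) (A : Set V) : Set V :=
  {z | inner ℝ x z = 1 ∧ ‖z‖⁻¹ • z ∈ A}

theorem one_sub_le_inner_of_mem_ball {x y : V} {η : ℝ} (hx : ‖x‖ = 1) (hy : y ∈ Metric.ball x η) :
    1 - η ≤ inner ℝ x y := by
  have h1 : inner ℝ x y = 1 + inner ℝ x (y - x) := by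
    rw [inner_sub_right, real_inner_self_eq_norm_sq, hx]; ring
  have h2 := abs_real_inner_le_norm x (y - x)
  rw [hx, one_mul, ← dist_eq_norm] at h2
  have h3 := Metric.mem_ball.1 hy
  linarith [neg_abs_le (inner ℝ x (y - x))]

/-- With `k` the cosine of the angle, `‖z - w‖² = (‖z‖ - ‖w‖)² + 2 ‖z‖ ‖w‖ (1 - k)`, while the left
side squared is `2 (1 - k)`. -/
theorem norm_normalize_sub_normalize_le {z w : V} (hz : 1 ≤ ‖z‖) (hw : 1 ≤ ‖w‖) :
    ‖‖z‖⁻¹ • z - ‖w‖⁻¹ • w‖ ≤ ‖z - w‖ := by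
  have hz0 : ‖z‖ ≠ 0 := by positivity
  have hw0 : ‖w‖ ≠ 0 := by positivity
  refine le_of_sq_le_sq ?_ (norm_nonneg _)
  rw [@norm_sub_sq_real, @norm_sub_sq_real, norm_smul, norm_smul, norm_inv, norm_inv, norm_norm,
    norm_norm, inv_mul_cancel₀ hz0, inv_mul_cancel₀ hw0, real_inner_smul_left,
    real_inner_smul_right]
  have hk : inner ℝ z w = ‖z‖ * ‖w‖ * (‖z‖⁻¹ * (‖w‖⁻¹ * inner ℝ z w)) := by field_simp
  have hk1 : ‖z‖⁻¹ * (‖w‖⁻¹ * inner ℝ z w) ≤ 1 := by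
    have := real_inner_le_norm z w
    rw [← mul_assoc, ← mul_inv, mul_comm, ← div_eq_mul_inv]
    exact div_le_one_of_le₀ this (by positivity)
  set k := ‖z‖⁻¹ * (‖w‖⁻¹ * inner ℝ z w)
  rw [hk]
  have h1 : 1 ≤ ‖z‖ * ‖w‖ := one_le_mul_of_one_le_of_one_le hz hw
  nlinarith [mul_nonneg (sub_nonneg.2 h1) (sub_nonneg.2 hk1), sq_nonneg (‖z‖ - ‖w‖)]

theorem norm_sub_inv_inner_smul_le {x y z : V} {η : ℝ} (hη : η < 1) (hx : ‖x‖ = 1)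
    (hy : ‖y‖ = 1) (hz : ‖z‖ = 1) (hyη : y ∈ Metric.ball x η) (hzη : z ∈ Metric.ball x η) :
    ‖(inner ℝ x y)⁻¹ • y - (inner ℝ x z)⁻¹ • z‖ ≤
      ((1 - η)⁻¹ + η * ((1 - η)⁻¹ * (1 - η)⁻¹)) * ‖y - z‖ := by
  have hc : 0 < 1 - η := by linarith
  have ha := one_sub_le_inner_of_mem_ball hx hyη
  have hb := one_sub_le_inner_of_mem_ball hx hzη
  set a := inner ℝ x y with ha'
  set b := inner ℝ x z with hb'
  have ha0 : 0 < a := by linarith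
  have hb0 : 0 < b := by linarith
  have hη0 : 0 ≤ η := (dist_nonneg.trans_lt (Metric.mem_ball.1 hyη)).le
  -- For unit vectors `y + z ⟂ y - z`, so `x` may be replaced by `x - (y + z) / 2`, of norm at most
  -- `η`. This factor `η` is what makes the Lipschitz constant tend to 1 as `η → 0`.
  have hab : |b - a| ≤ η * ‖y - z‖ := by
    have h0 : inner ℝ (y + z) (y - z) = 0 := by
      rw [inner_add_left, inner_sub_right, inner_sub_right, real_inner_self_eq_norm_sq,
        real_inner_self_eq_norm_sq, hy, hz, real_inner_comm]; ring
    have h1 : b - a = inner ℝ ((1 / 2 : ℝ) • ((y - x) + (z - x))) (y - z) := by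
      have : (1 / 2 : ℝ) • ((y - x) + (z - x)) = (1 / 2 : ℝ) • (y + z) - x := by module
      rw [this, inner_sub_left, real_inner_smul_left, h0, inner_sub_right]; ring
    rw [h1]
    refine (abs_real_inner_le_norm _ _).trans ?_
    gcongr
    rw [norm_smul]
    have h2 := norm_add_le (y - x) (z - x)
    rw [Metric.mem_ball, dist_eq_norm] at hyη hzη
    norm_num
    linarith
  have hdec : a⁻¹ • y - b⁻¹ • z = a⁻¹ • (y - z) + ((b - a) * (a⁻¹ * b⁻¹)) • z := by
    have : (b - a) * (a⁻¹ * b⁻¹) = a⁻¹ - b⁻¹ := by field_simp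
    rw [this]; module
  rw [hdec]
  refine (norm_add_le _ _).trans ?_
  rw [norm_smul, norm_smul, hz, mul_one, Real.norm_eq_abs, Real.norm_eq_abs, abs_mul,
    abs_of_pos (inv_pos.2 ha0), abs_of_pos (by positivity : 0 < a⁻¹ * b⁻¹), add_mul]
  have ha2 : a⁻¹ ≤ (1 - η)⁻¹ := by gcongr
  have hb2 : b⁻¹ ≤ (1 - η)⁻¹ := by gcongr
  have := mul_le_mul hab (mul_le_mul ha2 hb2 (by positivity) (by positivity)) (by positivity)
    (by positivity)
  nlinarith [mul_le_mul_of_nonneg_right ha2 (norm_nonneg (y - z))]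

theorem centralProjection_eq_image {x : V} {η : ℝ} {A : Set V} (hη : η < 1) (hx : ‖x‖ = 1)
    (hA : A ⊆ Metric.sphere 0 1) (hAx : A ⊆ Metric.ball x η) :
    centralProjection x A = (fun y => (inner ℝ x y)⁻¹ • y) '' A := by
  ext z
  constructor
  · rintro ⟨h1, h2⟩
    refine ⟨_, h2, ?_⟩
    have hz : ‖z‖ ≠ 0 := by
      intro h
      rw [norm_eq_zero] at h
      simp [h] at h1
    simp only [real_inner_smul_right, h1, smul_smul]
    simp [hz]
  · rintro ⟨y, hy, rfl⟩
    have h1 : 0 < inner ℝ x y := by linarith [one_sub_le_inner_of_mem_ball hx (hAx hy)]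
    have hy1 : ‖y‖ = 1 := by simpa using hA hy
    refine ⟨by simp [real_inner_smul_right, h1.ne'], ?_⟩
    rw [norm_smul, hy1, norm_inv, Real.norm_eq_abs, abs_of_pos h1, smul_smul]
    simpa [h1.ne'] using hy

theorem image_normalize_centralProjection {x : V} {η : ℝ} {A : Set V} (hη : η < 1) (hx : ‖x‖ = 1)
    (hA : A ⊆ Metric.sphere 0 1) (hAx : A ⊆ Metric.ball x η) :
    (fun z => ‖z‖⁻¹ • z) '' centralProjection x A = A := by
  refine subset_antisymm ?_ ?_
  · rintro _ ⟨z, hz, rfl⟩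
    exact hz.2
  · intro y hy
    rw [centralProjection_eq_image hη hx hA hAx]
    refine ⟨_, ⟨y, hy, rfl⟩, ?_⟩
    have h1 : 0 < inner ℝ x y := by linarith [one_sub_le_inner_of_mem_ball hx (hAx hy)]
    have hy1 : ‖y‖ = 1 := by simpa using hA hy
    simp only [norm_smul, hy1, norm_inv, Real.norm_eq_abs, abs_of_pos h1, smul_smul]
    simp [h1.ne']

/-- On a cap of radius `η` around `x`, heights `⟪x, u⟫` lie in `[1 - η, 1]`, so the spherical cone
sits between the flat cones of heights `1 - η` and `1`. -/
theorem sphericalCone_subset_flatCone {x : V} {η : ℝ} {A : Set V} (hη : η < 1) (hx : ‖x‖ = 1)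
    (hAx : A ⊆ Metric.ball x η) :
    sphericalCone A ⊆ flatCone x 1 (centralProjection x A) := by
  rintro w ⟨hw0, hw1, hwA⟩
  have hw : 0 < ‖w‖ := norm_pos_iff.2 hw0
  have h1 := one_sub_le_inner_of_mem_ball hx (hAx hwA)
  rw [real_inner_smul_right] at h1
  have h2 : 0 < inner ℝ x w := by
    have : 0 < ‖w‖⁻¹ * inner ℝ x w := by linarith
    exact pos_of_mul_pos_right this (by positivity)
  refine ⟨h2, ?_, ?_, ?_⟩
  · have := real_inner_le_norm x w
    rw [hx] at this
    linarith
  · simp [real_inner_smul_right, h2.ne']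
  · rw [norm_smul, norm_inv, Real.norm_eq_abs, abs_of_pos h2, smul_smul]
    convert hwA using 2
    field_simp

theorem flatCone_subset_sphericalCone {x : V} {η : ℝ} {A : Set V} (hx : ‖x‖ = 1)
    (hAx : A ⊆ Metric.ball x η) :
    flatCone x (1 - η) (centralProjection x A) ⊆ sphericalCone A := by
  rintro w ⟨h1, h2, -, h3⟩
  rw [norm_smul, norm_inv, Real.norm_eq_abs, abs_of_pos h1, smul_smul] at h3
  have hw0 : w ≠ 0 := by rintro rfl; simp at h1
  have hw : 0 < ‖w‖ := norm_pos_iff.2 hw0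
  have h4 : ((inner ℝ x w)⁻¹ * ‖w‖)⁻¹ * (inner ℝ x w)⁻¹ = ‖w‖⁻¹ := by field_simp
  rw [h4] at h3
  refine ⟨hw0, ?_, h3⟩
  have h5 := one_sub_le_inner_of_mem_ball hx (hAx h3)
  rw [real_inner_smul_right] at h5
  by_contra! hcon
  have : ‖w‖⁻¹ * inner ℝ x w ≤ 1 * inner ℝ x w := by
    gcongr
    exact inv_le_one_of_one_le₀ hcon
  linarith

variable [MeasurableSpace V] [BorelSpace V]

omit [InnerProductSpace ℝ V] in
theorem LipschitzOnWith.euclideanHausdorffMeasure_image_le {K : NNReal} {f : V → V} {s : Set V}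
    (hf : LipschitzOnWith K f s) (d : ℕ) : μHE[d] (f '' s) ≤ (K : ℝ≥0∞) ^ d * μHE[d] s := by
  have := hf.hausdorffMeasure_image_le (d := d) (by positivity)
  simp only [Measure.euclideanHausdorffMeasure_def, Measure.smul_apply, ENNReal.smul_def,
    smul_eq_mul]
  rw [ENNReal.rpow_natCast] at this
  rw [mul_left_comm]
  gcongr

theorem measurableSet_flatCone [FiniteDimensional ℝ V] {x : V} {h : ℝ} {F : Set V}
    (hF : MeasurableSet F) : MeasurableSet (flatCone x h F) := by
  have hm : Measurable fun w : V => inner ℝ x w := by fun_prop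
  refine (measurableSet_lt measurable_const hm).inter
    ((measurableSet_lt hm measurable_const).inter ?_)
  exact (hm.inv.smul measurable_id) hF

theorem measurableSet_centralProjection [FiniteDimensional ℝ V] {x : V} {A : Set V}
    (hA : MeasurableSet A) : MeasurableSet (centralProjection x A) := by
  have hm : Measurable fun w : V => inner ℝ x w := by fun_prop
  refine (measurableSet_eq_fun hm measurable_const).inter ?_
  exact (measurable_norm.inv.smul measurable_id) hA

-- Slicing along `x`: the slice at height `t` is `t • F`, whose measure scales by `t ^ (dim - 1)`.
open scoped Pointwise in
theorem volume_flatCone [FiniteDimensional ℝ V] {x : V} (hx : ‖x‖ = 1) {h : ℝ} (hh : 0 ≤ h)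
    {F : Set V} (hF : MeasurableSet F) (hFx : ∀ z ∈ F, inner ℝ x z = 1) :
    (Module.finrank ℝ V : ℝ≥0∞) * volume (flatCone x h F) =
      ENNReal.ofReal (h ^ Module.finrank ℝ V) * μHE[Module.finrank ℝ V - 1] F := by
  have hx0 : x ≠ 0 := by rintro rfl; simp at hx
  have : Nontrivial V := ⟨x, 0, hx0⟩
  obtain ⟨m, hm⟩ : ∃ m, Module.finrank ℝ V = m + 1 :=
    Nat.exists_eq_succ_of_ne_zero Module.finrank_pos.ne'
  have hslice : ∀ t : ℝ, μHE[Module.finrank ℝ V - 1]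
      (flatCone x h F ∩ AffineSubspace.mk' (t • x +ᵥ (0 : V)) (ℝ ∙ x)ᗮ) =
      (Ioo 0 h).indicator (fun t => ENNReal.ofReal (t ^ m) * μHE[m] F) t := by
    intro t
    have hmem : ∀ w : V, w ∈ (AffineSubspace.mk' (t • x +ᵥ (0 : V)) (ℝ ∙ x)ᗮ : Set V) ↔
        inner ℝ x w = t := by
      intro w
      rw [SetLike.mem_coe, AffineSubspace.mem_mk',
        Submodule.mem_orthogonal_singleton_iff_inner_right]
      simp [inner_sub_right, real_inner_smul_right, hx, sub_eq_zero]
    by_cases ht : t ∈ Ioo 0 h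
    · have hset : flatCone x h F ∩ AffineSubspace.mk' (t • x +ᵥ (0 : V)) (ℝ ∙ x)ᗮ = t • F := by
        ext w
        rw [mem_inter_iff, hmem, mem_smul_set_iff_inv_smul_mem₀ ht.1.ne']
        constructor
        · rintro ⟨⟨-, -, h3⟩, rfl⟩
          exact h3
        · intro hw
          have h4 := hFx _ hw
          rw [real_inner_smul_right, inv_mul_eq_one₀ ht.1.ne'] at h4
          exact ⟨⟨h4 ▸ ht.1, h4 ▸ ht.2, h4 ▸ hw⟩, h4.symm⟩
      rw [hset, Measure.euclideanHausdorffMeasure_smul₀ _ ht.1.ne', indicator_of_mem ht, hm,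
        ENNReal.smul_def, smul_eq_mul, ENNReal.ofReal_pow ht.1.le]
      simp [← ofReal_norm, ← enorm_eq_nnnorm, abs_of_pos ht.1]
    · rw [indicator_of_notMem ht]
      refine (congrArg _ (eq_empty_iff_forall_notMem.2 ?_)).trans measure_empty
      rintro w ⟨⟨h1, h2, -⟩, h3⟩
      rw [hmem] at h3
      exact ht ⟨h3 ▸ h1, h3 ▸ h2⟩
  have h1 := EuclideanGeometry.euclideanHausdorffMeasure_eq_lintegral (0 : V) hx0
    (measurableSet_flatCone (x := x) (h := h) hF)
  simp_rw [hslice] at h1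
  rw [InnerProductSpace.euclideanHausdorffMeasure_eq_volume, lintegral_indicator measurableSet_Ioo,
    lintegral_mul_const _ (by fun_prop)] at h1
  have hint : ∫⁻ t in Ioo 0 h, ENNReal.ofReal (t ^ m) = ENNReal.ofReal (h ^ (m + 1) / (m + 1)) := by
    rw [Measure.restrict_congr_set Ioo_ae_eq_Ioc, ← ofReal_integral_eq_lintegral_ofReal,
      ← intervalIntegral.integral_of_le hh]
    · simp
    · exact (intervalIntegral.intervalIntegrable_pow _).1
    · filter_upwards [ae_restrict_mem measurableSet_Ioc] with y hy
      exact pow_nonneg hy.1.le _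
  rw [h1, hint, ← ofReal_norm, hx, ENNReal.ofReal_one, one_mul, hm, Nat.add_sub_cancel,
    ← mul_assoc, ← ENNReal.ofReal_natCast, ← ENNReal.ofReal_mul (by positivity)]
  congr 2
  push_cast
  field_simp

theorem volume_sphericalCone_le [FiniteDimensional ℝ V] {x : V} {η : ℝ} {A : Set V} (hη0 : 0 ≤ η)
    (hη : η < 1)
    (hx : ‖x‖ = 1) (hA : A ⊆ Metric.sphere 0 1) (hAx : A ⊆ Metric.ball x η)
    (hAm : MeasurableSet A) :
    (Module.finrank ℝ V : ℝ≥0∞) * volume (sphericalCone A) ≤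
      ENNReal.ofReal (((1 - η)⁻¹ + η * ((1 - η)⁻¹ * (1 - η)⁻¹)) ^ (Module.finrank ℝ V - 1)) *
        μHE[Module.finrank ℝ V - 1] A := by
  have hc : 0 < 1 - η := by linarith
  set L := (1 - η)⁻¹ + η * ((1 - η)⁻¹ * (1 - η)⁻¹) with hL
  have hL0 : 0 ≤ L := by positivity
  calc (Module.finrank ℝ V : ℝ≥0∞) * volume (sphericalCone A)
      ≤ (Module.finrank ℝ V : ℝ≥0∞) * volume (flatCone x 1 (centralProjection x A)) := by
        gcongr
        exact sphericalCone_subset_flatCone hη hx hAx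
    _ = μHE[Module.finrank ℝ V - 1] (centralProjection x A) := by
        rw [volume_flatCone hx zero_le_one (measurableSet_centralProjection hAm) fun z hz => hz.1]
        simp
    _ ≤ _ := by
        rw [centralProjection_eq_image hη hx hA hAx, ENNReal.ofReal_pow hL0]
        refine LipschitzOnWith.euclideanHausdorffMeasure_image_le (K := L.toNNReal) ?_ _
        refine LipschitzOnWith.of_dist_le_mul fun y hy z hz => ?_
        rw [dist_eq_norm, dist_eq_norm, Real.coe_toNNReal _ hL0]
        exact norm_sub_inv_inner_smul_le hη hx (by simpa using hA hy) (by simpa using hA hz)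
          (hAx hy) (hAx hz)

theorem le_volume_sphericalCone [FiniteDimensional ℝ V] {x : V} {η : ℝ} {A : Set V}
    (hη : η < 1)
    (hx : ‖x‖ = 1) (hA : A ⊆ Metric.sphere 0 1) (hAx : A ⊆ Metric.ball x η)
    (hAm : MeasurableSet A) :
    ENNReal.ofReal ((1 - η) ^ Module.finrank ℝ V) * μHE[Module.finrank ℝ V - 1] A ≤
      (Module.finrank ℝ V : ℝ≥0∞) * volume (sphericalCone A) := by
  have hc : 0 < 1 - η := by linarith
  calc ENNReal.ofReal ((1 - η) ^ Module.finrank ℝ V) * μHE[Module.finrank ℝ V - 1] A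
      ≤ ENNReal.ofReal ((1 - η) ^ Module.finrank ℝ V) *
          μHE[Module.finrank ℝ V - 1] (centralProjection x A) := by
        refine mul_le_mul_right ?_ _
        conv_lhs => rw [← image_normalize_centralProjection hη hx hA hAx]
        have hlip : LipschitzOnWith 1 (fun z : V => ‖z‖⁻¹ • z) (centralProjection x A) := by
          have hn : ∀ z ∈ centralProjection x A, 1 ≤ ‖z‖ := fun z hz => by
            have := real_inner_le_norm x z
            rwa [hx, hz.1, one_mul] at this
          refine LipschitzOnWith.of_dist_le_mul fun y hy z hz => ?_
          rw [dist_eq_norm, dist_eq_norm, NNReal.coe_one, one_mul]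
          exact norm_normalize_sub_normalize_le (hn y hy) (hn z hz)
        simpa using hlip.euclideanHausdorffMeasure_image_le (Module.finrank ℝ V - 1)
    _ = (Module.finrank ℝ V : ℝ≥0∞) * volume (flatCone x (1 - η) (centralProjection x A)) := by
        rw [volume_flatCone hx hc.le (measurableSet_centralProjection hAm) fun z hz => hz.1]
    _ ≤ _ := by
        gcongr
        exact flatCone_subset_sphericalCone hx hAx

-- Cover `S` by finitely many balls and split a set along them one ball at a time.
omit [InnerProductSpace ℝ V] in
theorem measure_le_of_forall_subset_ball {μ ν : Measure V} {S : Set V} (hS : IsCompact S) {η : ℝ}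
    (hη : 0 < η) (h : ∀ x ∈ S, ∀ A ⊆ S ∩ Metric.ball x η, MeasurableSet A → μ A ≤ ν A) :
    μ S ≤ ν S := by
  obtain ⟨t, hts, htf, hcov⟩ := hS.finite_cover_balls hη
  have key : ∀ t : Set V, t.Finite → t ⊆ S → ∀ A ⊆ S, A ⊆ ⋃ x ∈ t, Metric.ball x η →
      MeasurableSet A → μ A ≤ ν A := by
    intro t ht
    induction t, ht using Set.Finite.induction_on with
    | empty => intro _ A _ hA _; simp at hA; simp [hA]
    | @insert a s has hs ih =>
      intro hsub A hAS hA hAm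
      rw [← measure_inter_add_sdiff A (measurableSet_ball (x := a) (ε := η)),
        ← measure_inter_add_sdiff (μ := ν) A (measurableSet_ball (x := a) (ε := η))]
      refine add_le_add (h a (hsub (mem_insert _ _)) _ (inter_subset_inter_left _ hAS)
        (hAm.inter measurableSet_ball)) (ih ((subset_insert _ _).trans hsub) _
        (sdiff_subset.trans hAS) ?_ (hAm.diff measurableSet_ball))
      rintro y ⟨hy, hya⟩
      have := hA hy
      rw [biUnion_insert] at this
      exact this.resolve_left hya
  exact key t htf hts S subset_rfl hcov hS.measurableSet

theorem euclideanHausdorffMeasure_sphere [FiniteDimensional ℝ V] [Nontrivial V] :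
    μHE[Module.finrank ℝ V - 1] (Metric.sphere (0 : V) 1) =
      (Module.finrank ℝ V : ℝ≥0∞) * volume (Metric.ball (0 : V) 1) := by
  set d := Module.finrank ℝ V
  -- The cone measure. On caps of radius `η` it agrees with Hausdorff measure up to factors tending
  -- to 1 as `η → 0`; globalize at fixed `η`, then pass to the limit.
  set ν : Measure V := (d : ℝ≥0∞) •
    (volume.restrict (Metric.ball (0 : V) 1 \ {0})).map (fun w : V => ‖w‖⁻¹ • w) with hν
  have hmn : Measurable fun w : V => ‖w‖⁻¹ • w := measurable_norm.inv.smul measurable_id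
  have hνA : ∀ A : Set V, MeasurableSet A → ν A = d * volume (sphericalCone A) := by
    intro A hA
    rw [hν, Measure.smul_apply, Measure.map_apply hmn hA, Measure.restrict_apply (hmn hA),
      smul_eq_mul]
    congr 2
    ext w
    simp [sphericalCone]
    tauto
  have hνS : ν (Metric.sphere 0 1) = d * volume (Metric.ball (0 : V) 1) := by
    rw [hνA _ Metric.isClosed_sphere.measurableSet,
      ← measure_sdiff_null (measure_singleton (0 : V)) (s := Metric.ball (0 : V) 1)]
    congr 2
    ext w
    simp +contextual [sphericalCone, norm_smul, and_comm]
  have hS : IsCompact (Metric.sphere (0 : V) 1) := isCompact_sphere 0 1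
  rw [← hνS]
  have hη : ∀ᶠ η : ℝ in 𝓝[>] 0, 0 < η ∧ η < 1 :=
    Ioo_mem_nhdsGT zero_lt_one
  have hlim : ∀ g : ℝ → ℝ, ContinuousAt g 0 → g 0 = 1 → ∀ a : ℝ≥0∞,
      Tendsto (fun η => ENNReal.ofReal (g η) * a) (𝓝[>] 0) (𝓝 a) := by
    intro g hg h0 a
    have h1 : Tendsto (fun η => ENNReal.ofReal (g η)) (𝓝[>] 0) (𝓝 1) := by
      have h2 : Tendsto g (𝓝[>] 0) (𝓝 1) := h0 ▸ hg.tendsto.mono_left nhdsWithin_le_nhds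
      simpa using ENNReal.tendsto_ofReal h2
    simpa using ENNReal.Tendsto.mul_const h1 (Or.inl one_ne_zero)
  refine le_antisymm ?_ ?_
  · refine le_of_tendsto (hlim (fun η => (1 - η) ^ d) (by fun_prop) (by simp)
      (μHE[d - 1] (Metric.sphere (0 : V) 1))) ?_
    filter_upwards [hη] with η hη
    rw [← smul_eq_mul, ← Measure.smul_apply]
    refine measure_le_of_forall_subset_ball hS hη.1 fun x hx A hA hAm => ?_
    rw [Measure.smul_apply, smul_eq_mul, hνA A hAm]
    exact le_volume_sphericalCone hη.2 (by simpa using hx) (hA.trans inter_subset_left)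
      (hA.trans inter_subset_right) hAm
  · refine ge_of_tendsto (hlim (fun η => ((1 - η)⁻¹ + η * ((1 - η)⁻¹ * (1 - η)⁻¹)) ^ (d - 1))
      (by fun_prop (disch := norm_num)) (by simp) (μHE[d - 1] (Metric.sphere (0 : V) 1))) ?_
    filter_upwards [hη] with η hη
    rw [← smul_eq_mul, ← Measure.smul_apply]
    refine measure_le_of_forall_subset_ball hS hη.1 fun x hx A hA hAm => ?_
    rw [hνA A hAm, Measure.smul_apply, smul_eq_mul]
    exact volume_sphericalCone_le hη.1.le hη.2 (by simpa using hx) (hA.trans inter_subset_left)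
      (hA.trans inter_subset_right) hAm

end Sphere

theorem sphereArea_eq (n : ℕ) (hn : 1 ≤ n) :
    sphereArea n = n * volume (Metric.ball (0 : EuclideanSpace ℝ (Fin n)) 1) := by
  have : Nonempty (Fin n) := ⟨⟨0, hn⟩⟩
  have h := euclideanHausdorffMeasure_sphere (V := EuclideanSpace ℝ (Fin n))
  rw [finrank_euclideanSpace_fin] at h
  exact h

/-! ### The tail integral of the kernel. -/

section RadialKernel

variable {n : ℕ}

theorem lintegral_kernel_tail (hn : 1 ≤ n) {s R : ℝ} (hs : 0 < s) (hR : 0 < R) :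
    ∫⁻ z in {z : EuclideanSpace ℝ (Fin n) | R ≤ ‖z‖}, ENNReal.ofReal (1 / ‖z‖ ^ ((n : ℝ) + 2 * s)) =
      n * volume (Metric.ball (0 : EuclideanSpace ℝ (Fin n)) 1) *
        ENNReal.ofReal (R ^ (-(2 * s)) / (2 * s)) := by
  have : Nonempty (Fin n) := ⟨⟨0, hn⟩⟩
  set f : ℝ → ℝ := (Ici R).indicator fun r => 1 / r ^ ((n : ℝ) + 2 * s) with hf
  have hset : MeasurableSet {z : EuclideanSpace ℝ (Fin n) | R ≤ ‖z‖} :=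
    measurableSet_le measurable_const measurable_norm
  -- The Jacobian `r ^ (n - 1)` turns `r ^ (-n - 2s)` into `r ^ (-1 - 2s)`.
  have hprod : EqOn (fun r : ℝ => r ^ (n - 1) • f r)
      ((Ici R).indicator fun r => r ^ (-1 - 2 * s)) (Ioi 0) := by
    intro r hr
    have hr0 : (0 : ℝ) < r := hr
    by_cases hrR : r ∈ Ici R
    · simp only [hf, indicator_of_mem hrR, smul_eq_mul]
      rw [one_div, ← Real.rpow_neg hr0.le, ← Real.rpow_natCast, ← Real.rpow_add hr0,
        Nat.cast_sub hn]
      congr 1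
      push_cast
      ring
    · simp [hf, indicator_of_notMem hrR]
  have hIci : Ioi 0 ∩ Ici R = Ici R := inter_eq_right.2 fun r hr => hR.trans_le hr
  have hint : IntegrableOn (fun r : ℝ => r ^ (n - 1) • f r) (Ioi 0) := by
    rw [integrableOn_congr_fun hprod measurableSet_Ioi, IntegrableOn,
      integrable_indicator_iff measurableSet_Ici, IntegrableOn,
      Measure.restrict_restrict measurableSet_Ici, inter_comm, hIci, ← IntegrableOn,
      integrableOn_Ici_iff_integrableOn_Ioi]
    exact integrableOn_Ioi_rpow_of_lt (by linarith) hR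
  have hval : ∫ r in Ioi (0 : ℝ), r ^ (n - 1) • f r = R ^ (-(2 * s)) / (2 * s) := by
    rw [setIntegral_congr_fun measurableSet_Ioi hprod, setIntegral_indicator measurableSet_Ici,
      hIci, integral_Ici_eq_integral_Ioi, integral_Ioi_rpow_of_lt (by linarith) hR]
    rw [show -1 - 2 * s + 1 = -(2 * s) by ring, neg_div_neg_eq]
  have hfin : Module.finrank ℝ (EuclideanSpace ℝ (Fin n)) = n := finrank_euclideanSpace_fin
  have hint' : Integrable (fun z : EuclideanSpace ℝ (Fin n) => f ‖z‖) := by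
    rw [integrable_fun_norm_addHaar, hfin]
    exact hint
  have h1 := integral_fun_norm_addHaar (volume : Measure (EuclideanSpace ℝ (Fin n))) f
  rw [hfin, hval] at h1
  have hnn : 0 ≤ᵐ[volume] fun z : EuclideanSpace ℝ (Fin n) => f ‖z‖ :=
    Eventually.of_forall fun z => indicator_nonneg (fun r hr => by
      have : 0 < r := hR.trans_le hr
      positivity) _
  rw [← lintegral_indicator hset]
  calc _ = ∫⁻ z : EuclideanSpace ℝ (Fin n), ENNReal.ofReal (f ‖z‖) := by
        refine lintegral_congr fun z => ?_
        by_cases hz : R ≤ ‖z‖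
        · rw [indicator_of_mem (by exact hz), hf, indicator_of_mem (by exact hz)]
        · rw [indicator_of_notMem (by exact hz), hf, indicator_of_notMem (by exact hz),
            ENNReal.ofReal_zero]
    _ = _ := by
        rw [← ofReal_integral_eq_lintegral_ofReal hint' hnn, h1, nsmul_eq_mul, smul_eq_mul,
          ENNReal.ofReal_mul (by positivity), ENNReal.ofReal_mul (by positivity),
          ofReal_measureReal, ENNReal.ofReal_natCast, mul_assoc]

theorem lintegral_kernel_tail_sub (hn : 1 ≤ n) {s R : ℝ} (hs : 0 < s) (hR : 0 < R)
    (x : EuclideanSpace ℝ (Fin n)) :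
    ∫⁻ y in {y | R ≤ ‖x - y‖}, ENNReal.ofReal (1 / ‖x - y‖ ^ ((n : ℝ) + 2 * s)) =
      n * volume (Metric.ball (0 : EuclideanSpace ℝ (Fin n)) 1) *
        ENNReal.ofReal (R ^ (-(2 * s)) / (2 * s)) := by
  rw [← lintegral_kernel_tail hn hs hR,
    ← lintegral_indicator (measurableSet_le measurable_const (by fun_prop)),
    ← lintegral_indicator (measurableSet_le measurable_const (by fun_prop)),
    ← lintegral_sub_left_eq_self _ x]
  simp only [indicator, mem_ofPred_eq, sub_sub_cancel]

theorem interaction_eq_lintegral_lintegral (s : ℝ) (S₁ S₂ : Set (EuclideanSpace ℝ (Fin n))) :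
    interaction s S₁ S₂ =
      ∫⁻ x in S₁, ∫⁻ y in S₂, ENNReal.ofReal (1 / ‖x - y‖ ^ ((n : ℝ) + 2 * s)) := by
  rw [interaction, Measure.volume_eq_prod, ← Measure.prod_restrict, lintegral_prod]
  fun_prop

theorem fractionalPerimeter_univ (s : ℝ) (E : Set (EuclideanSpace ℝ (Fin n))) :
    fractionalPerimeter s E univ = interaction s E Eᶜ := by
  simp [fractionalPerimeter, interaction]

end RadialKernel

/-! ### Tubular neighbourhoods of a regular level set have volume `O(t)`. -/

section Thickening

variable {V : Type*} [NormedAddCommGroup V] [NormedSpace ℝ V] [FiniteDimensional ℝ V]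
  [MeasurableSpace V] [BorelSpace V] (μ : Measure V) [μ.IsAddHaarMeasure]

/-- Packing: if no two points of `A` differ by `a • v` with `a ≥ δ`, then disjoint translates of `A`
along `v` bound its measure. -/
theorem measureReal_le_of_forall_add_smul_notMem {p v : V} {ρ δ : ℝ} {A : Set V} (hδ : 0 < δ)
    (hv : v ≠ 0) (hρ : 0 < ρ) (hAm : MeasurableSet A) (hAp : A ⊆ Metric.ball p ρ)
    (hA : ∀ x ∈ A, ∀ a, δ ≤ a → x + a • v ∉ A) :
    μ.real A ≤ μ.real (Metric.ball p (2 * ρ)) * (δ * ‖v‖ / ρ) := by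
  have hv0 : 0 < ‖v‖ := norm_pos_iff.2 hv
  -- The largest number of steps `δ • v` with total length at most `ρ`, so the `N + 1` translates
  -- stay in the ball of radius `2ρ`.
  set N := ⌊ρ / (δ * ‖v‖)⌋₊ with hN
  set T : ℕ → Set V := fun k => (fun x => x + (-(k * δ)) • v) ⁻¹' A with hT
  have hTm : ∀ k, MeasurableSet (T k) := fun k => (measurable_id.add_const _) hAm
  have hTμ : ∀ k, μ (T k) = μ A := fun k => measure_preimage_add_right μ _ A
  have hlt : ∀ i j : ℕ, i < j → Disjoint (T i) (T j) := by
    intro i j hij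
    rw [Set.disjoint_left]
    intro x hxi hxj
    have hij' : (i : ℝ) + 1 ≤ j := by exact_mod_cast hij
    refine hA _ hxj ((j - i) * δ) (by nlinarith) ?_
    have h1 : x + (-(j * δ)) • v + ((j - i) * δ) • v = x + (-(i * δ)) • v := by module
    exact h1 ▸ hxi
  have hdisj : (Finset.range (N + 1) : Set ℕ).PairwiseDisjoint T := by
    intro i _ j _ hij
    rcases lt_or_gt_of_ne hij with h | h
    · exact hlt i j h
    · exact (hlt j i h).symm
  have hsub : ⋃ k ∈ Finset.range (N + 1), T k ⊆ Metric.ball p (2 * ρ) := by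
    intro x hx
    simp only [mem_iUnion, Finset.mem_range] at hx
    obtain ⟨k, hk, hxk⟩ := hx
    have h1 := hAp hxk
    have hk' : (k : ℝ) ≤ ρ / (δ * ‖v‖) :=
      (Nat.le_floor_iff (by positivity)).1 (Nat.lt_succ_iff.1 hk)
    rw [le_div_iff₀ (by positivity)] at hk'
    have h2 : dist x (x + (-(k * δ)) • v) ≤ ρ := by
      rw [dist_self_add_right, norm_smul, norm_neg, Real.norm_eq_abs, abs_of_nonneg (by positivity)]
      linarith
    have h3 := dist_triangle x (x + (-(k * δ)) • v) p
    rw [Metric.mem_ball] at h1 ⊢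
    linarith
  have hsum : ((N : ℝ) + 1) * μ.real A ≤ μ.real (Metric.ball p (2 * ρ)) := by
    have h1 := measureReal_mono (μ := μ) hsub measure_ball_lt_top.ne
    rw [measureReal_biUnion_finset hdisj (fun k _ => hTm k)
      (fun k _ => by rw [hTμ]; exact ((measure_mono hAp).trans_lt measure_ball_lt_top).ne)] at h1
    simpa [Measure.real, hTμ] using h1
  have hN1 : ρ / (δ * ‖v‖) ≤ N + 1 := (Nat.lt_floor_add_one _).le
  have h4 : ρ / (δ * ‖v‖) * μ.real A ≤ μ.real (Metric.ball p (2 * ρ)) :=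
    (mul_le_mul_of_nonneg_right hN1 measureReal_nonneg).trans hsum
  rw [← mul_div_assoc, le_div_iff₀ hρ]
  rw [div_mul_eq_mul_div, div_le_iff₀ (by positivity)] at h4
  linarith

/-- Near a point where a set is contained in a regular level set of a strictly differentiable
function, the volume of its tubular neighbourhoods grows at most linearly. -/
theorem HasStrictFDerivAt.exists_measure_inter_thickening_le {f : V → ℝ} {f' : V →L[ℝ] ℝ} {p : V}
    (hf : HasStrictFDerivAt f f' p) (hf' : f' ≠ 0) {S U : Set V} (hU : U ∈ 𝓝 p)
    (hS : ∀ z ∈ S ∩ U, f z = 0) :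
    ∃ ρ > 0, ∃ C : ℝ, 0 ≤ C ∧ ∀ t > 0,
      μ (Metric.ball p ρ ∩ Metric.thickening t S) ≤ ENNReal.ofReal (C * t) := by
  obtain ⟨w, hw⟩ : ∃ w, f' w ≠ 0 := by
    by_contra! h
    exact hf' (ContinuousLinearMap.ext h)
  obtain ⟨v, hv⟩ : ∃ v, f' v = 1 := ⟨(f' w)⁻¹ • w, by simp [hw]⟩
  have hv0 : v ≠ 0 := by rintro rfl; simp at hv
  have hvn : 0 < ‖v‖ := norm_pos_iff.2 hv0
  -- Since `f' v = 1`, this makes `f` change by at least `a / 2` along `a • v`.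
  set ε := 1 / (2 * ‖v‖) with hε
  have hε0 : 0 < ε := by positivity
  have hεv : ε * ‖v‖ = 1 / 2 := by rw [hε]; field_simp
  have h1 := hf.isLittleO.def hε0
  obtain ⟨r₁, hr₁, hball₁⟩ := Metric.eventually_nhds_iff_ball.1 h1
  obtain ⟨r₂, hr₂, hball₂⟩ := Metric.mem_nhds_iff.1 hU
  set r := min r₁ r₂
  have hr : 0 < r := lt_min hr₁ hr₂
  have hstrict : ∀ x ∈ Metric.ball p r, ∀ y ∈ Metric.ball p r,
      |f x - f y - f' (x - y)| ≤ ε * ‖x - y‖ := by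
    intro x hx y hy
    refine hball₁ (x, y) ?_
    rw [← ball_prod_same]
    exact ⟨Metric.ball_subset_ball (min_le_left _ _) hx,
      Metric.ball_subset_ball (min_le_left _ _) hy⟩
  set L := ‖f'‖ + ε with hL
  have hL0 : 0 < L := by positivity
  set ρ := r / 2 with hρ
  have hρ0 : 0 < ρ := by positivity
  set W := μ.real (Metric.ball p (2 * ρ)) with hW
  -- The first term comes from packing when `t < ρ`; the second covers `ρ ≤ t`, where the trivial
  -- bound `W` suffices.
  refine ⟨ρ, hρ0, W * (4 * L * ‖v‖ / ρ + 1 / ρ), by positivity, fun t ht => ?_⟩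
  set A := Metric.ball p ρ ∩ Metric.thickening t S with hA
  have hAfin : μ A ≠ ⊤ := ((measure_mono inter_subset_left).trans_lt measure_ball_lt_top).ne
  rw [← ofReal_measureReal hAfin]
  refine ENNReal.ofReal_le_ofReal ?_
  by_cases htρ : ρ ≤ t
  · have h2 : μ.real A ≤ W := measureReal_mono
      (inter_subset_left.trans (Metric.ball_subset_ball (by linarith))) measure_ball_lt_top.ne
    have h3 : 1 ≤ 1 / ρ * t := by rw [one_div, ← div_eq_inv_mul]; exact (one_le_div hρ0).2 htρ
    calc μ.real A ≤ W * 1 := by linarith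
      _ ≤ W * (4 * L * ‖v‖ / ρ * t + 1 / ρ * t) := by
          have : 0 ≤ 4 * L * ‖v‖ / ρ * t := by positivity
          gcongr
          linarith
      _ = _ := by ring
  · push Not at htρ
    have hval : ∀ x ∈ A, |f x| < L * t := by
      rintro x ⟨hx, hxt⟩
      obtain ⟨z, hzS, hz⟩ := Metric.mem_thickening_iff.1 hxt
      have hzr : z ∈ Metric.ball p r := by
        have := dist_triangle z x p
        rw [dist_comm z x] at this
        rw [Metric.mem_ball] at hx ⊢
        linarith
      have hxr : x ∈ Metric.ball p r := Metric.ball_subset_ball (by linarith) hx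
      have hz0 := hS z ⟨hzS, hball₂ (Metric.ball_subset_ball (min_le_right _ _) hzr)⟩
      have h2 := hstrict x hxr z hzr
      rw [hz0, sub_zero] at h2
      have h3 := f'.le_opNorm (x - z)
      rw [Real.norm_eq_abs] at h3
      rw [dist_eq_norm] at hz
      have h4 := abs_sub_abs_le_abs_sub (f x) (f' (x - z))
      have h5 : L * ‖x - z‖ < L * t := by gcongr
      rw [hL, add_mul] at h5
      linarith
    -- On `A`, `|f| < L * t`, so two values differ by less than `2 * L * t`; a move by `a • v` with
    -- `a ≥ 4 * L * t` changes `f` by at least that much.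
    have hpack := measureReal_le_of_forall_add_smul_notMem μ (p := p) (v := v) (ρ := ρ)
      (δ := 4 * L * t) (A := A) (by positivity) hv0 hρ0
      (Metric.isOpen_ball.inter Metric.isOpen_thickening).measurableSet inter_subset_left ?_
    · calc μ.real A ≤ W * (4 * L * t * ‖v‖ / ρ) := hpack
        _ ≤ W * (4 * L * t * ‖v‖ / ρ + 1 / ρ * t) := by
            gcongr
            have : 0 ≤ 1 / ρ * t := by positivity
            linarith
        _ = _ := by ring
    · intro x hx a ha hxa
      have ha0 : 0 < a := lt_of_lt_of_le (by positivity) ha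
      have h2 := hstrict (x + a • v) (Metric.ball_subset_ball (by linarith) hxa.1) x
        (Metric.ball_subset_ball (by linarith) hx.1)
      rw [add_sub_cancel_left, map_smul, hv, norm_smul, Real.norm_eq_abs, _root_.abs_of_pos ha0,
        smul_eq_mul, mul_one, mul_left_comm, hεv] at h2
      have h3 := abs_lt.1 (hval _ hx)
      have h4 := abs_lt.1 (hval _ hxa)
      have h5 := abs_le.1 h2
      linarith [h3.1, h4.2, h5.1]

end Thickening

/-! ### Bounded sets with smooth boundary. -/

section Boundary

variable {n : ℕ} {E : Set (EuclideanSpace ℝ (Fin n))}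

theorem isCompact_frontier_of_isBounded (hE : Bornology.IsBounded E) : IsCompact (frontier E) :=
  Metric.isCompact_of_isClosed_isBounded isClosed_frontier
    (hE.closure.subset frontier_subset_closure)

/-- Compactness glues the local bounds into one on an open `O` containing the boundary, and small
thickenings lie inside `O`. -/
theorem HasSmoothBoundary.exists_volume_thickening_le (hE : HasSmoothBoundary E)
    (hb : Bornology.IsBounded E) :
    ∃ t₀ > 0, ∃ C : ℝ, 0 ≤ C ∧ ∀ t > 0, t ≤ t₀ →
      volume (Metric.thickening t (frontier E)) ≤ ENNReal.ofReal (C * t) := by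
  have hK := isCompact_frontier_of_isBounded hb
  obtain ⟨O, hO, hKO, C, hC, h⟩ : ∃ O, IsOpen O ∧ frontier E ⊆ O ∧ ∃ C : ℝ, 0 ≤ C ∧ ∀ t > 0,
      volume (O ∩ Metric.thickening t (frontier E)) ≤ ENNReal.ofReal (C * t) := by
    refine hK.induction_on (p := fun s => ∃ O, IsOpen O ∧ s ⊆ O ∧ ∃ C : ℝ, 0 ≤ C ∧ ∀ t > 0,
      volume (O ∩ Metric.thickening t (frontier E)) ≤ ENNReal.ofReal (C * t)) ?_ ?_ ?_ ?_
    · exact ⟨∅, isOpen_empty, subset_rfl, 0, le_rfl, by simp⟩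
    · rintro s s' hss ⟨O, hO, hsO, h⟩
      exact ⟨O, hO, hss.trans hsO, h⟩
    · rintro s s' ⟨O, hO, hsO, C, hC, h⟩ ⟨O', hO', hsO', C', hC', h'⟩
      refine ⟨O ∪ O', hO.union hO', union_subset_union hsO hsO', C + C', by positivity,
        fun t ht => ?_⟩
      rw [union_inter_distrib_right, add_mul, ENNReal.ofReal_add (by positivity) (by positivity)]
      exact (measure_union_le _ _).trans (add_le_add (h t ht) (h' t ht))
    · intro p hp
      obtain ⟨U, f, hU, hpU, hf, hf', hfU⟩ := hE p hp
      have hstrict : HasStrictFDerivAt f (fderiv ℝ f p) p :=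
        (hf.contDiffAt (hU.mem_nhds hpU)).hasStrictFDerivAt (by simp)
      obtain ⟨ρ, hρ, C, hC, h⟩ := hstrict.exists_measure_inter_thickening_le volume hf'
        (S := frontier E) (hU.mem_nhds hpU) fun z hz => (hfU ▸ hz : z ∈ {x | f x = 0} ∩ U).1
      exact ⟨Metric.ball p ρ, mem_nhdsWithin_of_mem_nhds (Metric.ball_mem_nhds p hρ),
        _, Metric.isOpen_ball, subset_rfl, C, hC, h⟩
  obtain ⟨t₀, ht₀, hsub⟩ := hK.exists_thickening_subset_open hO hKO
  refine ⟨t₀, ht₀, C, hC, fun t ht htt => ?_⟩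
  rw [← inter_eq_right.2 ((Metric.thickening_mono htt _).trans hsub)]
  exact h t ht

theorem HasSmoothBoundary.volume_frontier (hE : HasSmoothBoundary E)
    (hb : Bornology.IsBounded E) : volume (frontier E) = 0 := by
  obtain ⟨t₀, ht₀, C, -, h⟩ := hE.exists_volume_thickening_le hb
  have hlim : Tendsto (fun t : ℝ => ENNReal.ofReal (C * t)) (𝓝[>] 0) (𝓝 0) := by
    have : Tendsto (fun t : ℝ => C * t) (𝓝[>] 0) (𝓝 0) :=
      ((continuous_const_mul C).tendsto' 0 0 (by simp)).mono_left nhdsWithin_le_nhds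
    simpa using ENNReal.tendsto_ofReal this
  refine le_antisymm (ge_of_tendsto hlim ?_) bot_le
  filter_upwards [Ioc_mem_nhdsGT ht₀] with t ht
  exact (measure_mono (Metric.self_subset_thickening ht.1 _)).trans (h t ht.1 ht.2)

/-- By connectedness, the segment from `x` to `y` meets the boundary. -/
theorem infDist_frontier_le_norm_sub {x y : EuclideanSpace ℝ (Fin n)} (hx : x ∈ E) (hy : y ∉ E) :
    Metric.infDist x (frontier E) ≤ ‖x - y‖ := by
  obtain ⟨z, hz, hzE⟩ : ∃ z ∈ segment ℝ x y, z ∈ frontier E := by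
    by_contra! h
    have hcov : segment ℝ x y ⊆ interior E ∪ interior Eᶜ := by
      intro z hz
      have := h z hz
      rw [interior_compl]
      by_contra! hcon
      rw [mem_union, not_or, mem_compl_iff, not_not] at hcon
      exact this ⟨hcon.2, hcon.1⟩
    have hdisj : Disjoint (interior E) (interior Eᶜ) :=
      disjoint_compl_right.mono interior_subset interior_subset
    have hxE : x ∈ interior E := (hcov (left_mem_segment ℝ x y)).resolve_right
      fun h' => interior_subset h' hx
    have := (convex_segment (𝕜 := ℝ) x y).isPreconnected.subset_left_of_subset_union isOpen_interior
      isOpen_interior hdisj hcov ⟨x, left_mem_segment ℝ x y, hxE⟩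
    exact hy (interior_subset (this (right_mem_segment ℝ x y)))
  refine (Metric.infDist_le_dist_of_mem hzE).trans ?_
  have := dist_add_dist_of_mem_segment hz
  rw [← dist_eq_norm]
  linarith [dist_nonneg (x := z) (y := y), dist_comm x z]

end Boundary

/-! ### Finiteness at one exponent, two-sided bounds, and the limit. -/

section Perimeter

variable {n : ℕ} {E : Set (EuclideanSpace ℝ (Fin n))}

/-- Measurability of `E` is not assumed; it follows from the boundary being null. -/
theorem HasSmoothBoundary.nullMeasurableSet (hE : HasSmoothBoundary E)
    (hb : Bornology.IsBounded E) : NullMeasurableSet E volume :=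
  nullMeasurableSet_of_null_frontier (hE.volume_frontier hb)

/-- Layer cake: the superlevel set at `l` lies in the thickening of radius `l ^ (-2)`, of volume at
most `C * l ^ (-2)`, which is integrable at infinity. -/
theorem HasSmoothBoundary.lintegral_infDist_rpow_lt_top (hE : HasSmoothBoundary E)
    (hb : Bornology.IsBounded E) (hne : (frontier E).Nonempty) :
    ∫⁻ x in E, ENNReal.ofReal (Metric.infDist x (frontier E) ^ (-(1 / 2) : ℝ)) < ⊤ := by
  obtain ⟨t₀, ht₀, C, hC, h⟩ := hE.exists_volume_thickening_le hb
  have hEfin : volume E < ⊤ := hb.measure_lt_top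
  rw [lintegral_eq_lintegral_meas_lt _
    (Eventually.of_forall fun x => Real.rpow_nonneg Metric.infDist_nonneg _)
    ((Metric.continuous_infDist_pt _).measurable.pow_const _).aemeasurable]
  -- The level beyond which `l ^ (-2) ≤ t₀`, so that the linear volume bound applies.
  set Λ := t₀ ^ (-(1 / 2) : ℝ) with hΛ
  have hΛ0 : 0 < Λ := Real.rpow_pos_of_pos ht₀ _
  rw [← Ioc_union_Ioi_eq_Ioi hΛ0.le]
  refine (lintegral_union_le _ _ _).trans_lt (ENNReal.add_lt_top.2 ⟨?_, ?_⟩)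
  · refine (setLIntegral_mono' (g := fun _ => volume E) measurableSet_Ioc fun l _ => ?_).trans_lt ?_
    · exact (measure_mono (subset_univ _)).trans (by simp)
    · rw [setLIntegral_const]
      exact ENNReal.mul_lt_top hEfin (by simp)
  · have hint : IntegrableOn (fun l : ℝ => C * l ^ (-2 : ℝ)) (Ioi Λ) :=
      (integrableOn_Ioi_rpow_of_lt (by norm_num) hΛ0).const_mul C
    refine (setLIntegral_mono' (g := fun l => ENNReal.ofReal (C * l ^ (-2 : ℝ))) measurableSet_Ioi
      fun l hl => ?_).trans_lt hint.lintegral_lt_top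
    have hl0 : 0 < l := hΛ0.trans hl
    refine ((Measure.restrict_le_self _).trans (measure_mono ?_)).trans
      (h (l ^ (-2 : ℝ)) (Real.rpow_pos_of_pos hl0 _) ?_)
    · intro x hx
      have hx' : l < Metric.infDist x (frontier E) ^ (-(1 / 2) : ℝ) := hx
      have hd : 0 < Metric.infDist x (frontier E) := by
        refine Metric.infDist_nonneg.lt_of_ne fun h0 => ?_
        rw [← h0, Real.zero_rpow (by norm_num)] at hx'
        exact hl0.not_gt hx'
      rw [Metric.mem_thickening_iff_infDist_lt hne]
      have h1 := Real.rpow_lt_rpow_of_neg hl0 hx' (by norm_num : (-2 : ℝ) < 0)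
      rw [← Real.rpow_mul hd.le] at h1
      norm_num at h1
      simpa using h1
    · have h1 := Real.rpow_lt_rpow_of_neg hΛ0 hl (by norm_num : (-2 : ℝ) < 0)
      rw [hΛ, ← Real.rpow_mul ht₀.le] at h1
      norm_num at h1
      simpa using h1.le

theorem HasSmoothBoundary.interaction_quarter_lt_top (hn : 1 ≤ n) (hE : HasSmoothBoundary E)
    (hb : Bornology.IsBounded E) : interaction (1 / 4) E Eᶜ < ⊤ := by
  -- `infDist` to the empty set is `0`, so an empty boundary is treated apart: then `E` or `Eᶜ` is
  -- empty.
  rcases (frontier E).eq_empty_or_nonempty with hemp | hne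
  · rcases frontier_eq_empty_iff.1 hemp with h | h
    · simp [h, interaction]
    · simp [h, interaction]
  rw [interaction_eq_lintegral_lintegral]
  set c := (n : ℝ≥0∞) * volume (Metric.ball (0 : EuclideanSpace ℝ (Fin n)) 1) with hc
  have hc_fin : c ≠ ⊤ := ENNReal.mul_ne_top (by simp) measure_ball_lt_top.ne
  have hSm : ∀ᵐ x ∂(volume : Measure (EuclideanSpace ℝ (Fin n))), x ∉ frontier E :=
    measure_eq_zero_iff_ae_notMem.1 (hE.volume_frontier hb)
  calc _ ≤ ∫⁻ x in E, c * ENNReal.ofReal 2 *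
        ENNReal.ofReal (Metric.infDist x (frontier E) ^ (-(1 / 2) : ℝ)) := by
        refine lintegral_mono_ae ?_
        filter_upwards [ae_restrict_mem₀ (hE.nullMeasurableSet hb), ae_restrict_of_ae hSm]
          with x hxE hxS
        have hd : 0 < Metric.infDist x (frontier E) :=
          (isClosed_frontier.notMem_iff_infDist_pos hne).1 hxS
        have hsub : Eᶜ ⊆ {y | Metric.infDist x (frontier E) ≤ ‖x - y‖} := fun y hy =>
          infDist_frontier_le_norm_sub hxE hy
        refine (lintegral_mono_set hsub).trans_eq ?_
        rw [lintegral_kernel_tail_sub hn (by norm_num) hd, ← hc, mul_assoc c (ENNReal.ofReal 2),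
          ← ENNReal.ofReal_mul (by norm_num)]
        congr 2
        norm_num
        ring
    _ < ⊤ := by
        rw [lintegral_const_mul' _ _ (ENNReal.mul_ne_top hc_fin ENNReal.ofReal_ne_top)]
        exact ENNReal.mul_lt_top (ENNReal.mul_ne_top hc_fin ENNReal.ofReal_ne_top).lt_top
          (hE.lintegral_infDist_rpow_lt_top hb hne)

theorem le_interaction_compl (hn : 1 ≤ n) (hE : NullMeasurableSet E volume) {s R : ℝ} (hs : 0 < s)
    (hR : 0 < R) (hER : ∀ x ∈ E, ∀ y ∈ E, ‖x - y‖ < R) :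
    n * volume (Metric.ball (0 : EuclideanSpace ℝ (Fin n)) 1) *
        ENNReal.ofReal (R ^ (-(2 * s)) / (2 * s)) * volume E ≤ interaction s E Eᶜ := by
  rw [interaction_eq_lintegral_lintegral, ← setLIntegral_const]
  refine lintegral_mono_ae ?_
  filter_upwards [ae_restrict_mem₀ hE] with x hx
  rw [← lintegral_kernel_tail_sub hn hs hR x]
  exact lintegral_mono_set fun y hy hyE => (hER x hx y hyE).not_ge hy

theorem kernel_le_of_norm_lt {z : EuclideanSpace ℝ (Fin n)} {s R : ℝ} (hs : 0 < s)
    (hs' : s ≤ 1 / 4) (hR : 1 ≤ R) (hz : ‖z‖ < R) :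
    1 / ‖z‖ ^ ((n : ℝ) + 2 * s) ≤ R * (1 / ‖z‖ ^ ((n : ℝ) + 2 * (1 / 4))) := by
  rcases (norm_nonneg z).eq_or_lt with h0 | h0
  -- At `z = 0` both kernels take the default value `1 / 0 = 0`.
  · rw [← h0, Real.zero_rpow (by positivity), Real.zero_rpow (by positivity)]
    simp
  · have h1 : ‖z‖ ^ (2 * (1 / 4) - 2 * s) ≤ R := by
      -- The exponent lies in `[0, 1]` because `0 < s ≤ 1/4`, and `1 ≤ R`.
      calc ‖z‖ ^ (2 * (1 / 4) - 2 * s) ≤ R ^ (2 * (1 / 4) - 2 * s) :=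
            Real.rpow_le_rpow h0.le hz.le (by linarith)
        _ ≤ R ^ (1 : ℝ) := Real.rpow_le_rpow_of_exponent_le hR (by linarith)
        _ = R := Real.rpow_one R
    have h2 : ‖z‖ ^ ((n : ℝ) + 2 * (1 / 4)) =
        ‖z‖ ^ ((n : ℝ) + 2 * s) * ‖z‖ ^ (2 * (1 / 4) - 2 * s) := by
      rw [← Real.rpow_add h0]; congr 1; ring
    have h3 := Real.rpow_pos_of_pos h0 ((n : ℝ) + 2 * s)
    have h4 := Real.rpow_pos_of_pos h0 (2 * (1 / 4) - 2 * s)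
    rw [h2, mul_one_div, div_le_div_iff₀ h3 (by positivity)]
    nlinarith

theorem interaction_compl_le (hn : 1 ≤ n) {s R : ℝ} (hs : 0 < s) (hs' : s ≤ 1 / 4) (hR : 1 ≤ R) :
    interaction s E Eᶜ ≤ ENNReal.ofReal R * interaction (1 / 4) E Eᶜ +
      n * volume (Metric.ball (0 : EuclideanSpace ℝ (Fin n)) 1) *
        ENNReal.ofReal (R ^ (-(2 * s)) / (2 * s)) * volume E := by
  have hR0 : 0 < R := by linarith
  rw [interaction_eq_lintegral_lintegral, interaction_eq_lintegral_lintegral, ← setLIntegral_const,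
    ← lintegral_const_mul' _ _ ENNReal.ofReal_ne_top, ← lintegral_add_right _ measurable_const]
  refine lintegral_mono fun x => ?_
  have hset : MeasurableSet {y : EuclideanSpace ℝ (Fin n) | R ≤ ‖x - y‖} :=
    measurableSet_le measurable_const (by fun_prop)
  have hker : Measurable fun y : EuclideanSpace ℝ (Fin n) =>
      ENNReal.ofReal (1 / ‖x - y‖ ^ ((n : ℝ) + 2 * s)) := by fun_prop
  dsimp only
  rw [← lintegral_kernel_tail_sub hn hs hR0 x, ← lintegral_const_mul' _ _ ENNReal.ofReal_ne_top,
    ← lintegral_indicator hset]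
  -- The tail may run over all `y`, so only the near part keeps the restriction to `Eᶜ`.
  refine le_trans ?_ (add_le_add_right (setLIntegral_le_lintegral Eᶜ _) _)
  rw [← lintegral_add_right _ (hker.indicator hset)]
  refine lintegral_mono fun y => ?_
  by_cases hy : R ≤ ‖x - y‖
  · dsimp only
    rw [indicator_of_mem (by exact hy)]
    exact le_add_self
  · refine le_add_right ?_
    rw [← ENNReal.ofReal_mul hR0.le]
    exact ENNReal.ofReal_le_ofReal (kernel_le_of_norm_lt hs hs' hR (not_le.1 hy))

theorem tendsto_ofReal_mul_kernel_tail {R : ℝ} (hR : 0 < R) {c : ℝ≥0∞} (hc : c ≠ ⊤) (v : ℝ≥0∞)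
    (hv : v ≠ ⊤) :
    Tendsto (fun s : ℝ => ENNReal.ofReal s * (c * ENNReal.ofReal (R ^ (-(2 * s)) / (2 * s)) * v))
      (𝓝[>] 0) (𝓝 (c / 2 * v)) := by
  have h1 : Tendsto (fun s : ℝ => R ^ (-(2 * s)) / 2) (𝓝[>] 0) (𝓝 (1 / 2)) := by
    have hc : ContinuousAt (fun s : ℝ => R ^ (-(2 * s)) / 2) 0 := by
      have : ContinuousAt (fun s : ℝ => R ^ (-(2 * s))) 0 :=
        continuousAt_const.rpow (by fun_prop) (Or.inl hR.ne')
      exact this.div_const 2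
    have := hc.tendsto
    simp only [mul_zero, neg_zero, Real.rpow_zero] at this
    exact this.mono_left nhdsWithin_le_nhds
  have h2 := ENNReal.tendsto_ofReal h1
  have h3 := ENNReal.Tendsto.mul_const (b := v)
    (ENNReal.Tendsto.const_mul (a := c) h2 (Or.inr hc)) (Or.inr hv)
  have h4 : c * ENNReal.ofReal (1 / 2) * v = c / 2 * v := by
    rw [div_eq_mul_inv c, one_div, ENNReal.ofReal_inv_of_pos two_pos]
    simp
  rw [h4] at h3
  refine h3.congr' ?_
  filter_upwards [self_mem_nhdsWithin] with s hs
  have hs0 : (0 : ℝ) < s := hs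
  have h5 : R ^ (-(2 * s)) / 2 = s * (R ^ (-(2 * s)) / (2 * s)) := by field_simp
  rw [h5, ENNReal.ofReal_mul hs0.le]
  ring

end Perimeter

theorem mainTheorem8 (n : ℕ) (hn : 3 ≤ n) (E : Set (EuclideanSpace ℝ (Fin n)))
    (hbdd : Bornology.IsBounded E) (hsmooth : HasSmoothBoundary E) :
    Tendsto (fun s : ℝ => ENNReal.ofReal s * fractionalPerimeter s E univ) (𝓝[>] 0)
      (𝓝 (sphereArea n / 2 * volume E)) := by
  have hn1 : 1 ≤ n := by omega
  obtain ⟨R₀, hR₀⟩ := Metric.isBounded_iff.1 hbdd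
  -- Adding 1 gives both `1 ≤ R` and strict inequality in `hER`.
  set R := max R₀ 0 + 1 with hR
  have hR1 : 1 ≤ R := le_add_of_nonneg_left (le_max_right _ _)
  have hR0 : 0 < R := by linarith
  have hER : ∀ x ∈ E, ∀ y ∈ E, ‖x - y‖ < R := fun x hx y hy => by
    have h1 := hR₀ hx hy
    rw [dist_eq_norm] at h1
    have h2 := le_max_left R₀ 0
    linarith
  simp_rw [fractionalPerimeter_univ]
  rw [sphereArea_eq n hn1]
  have hc : (n : ℝ≥0∞) * volume (Metric.ball (0 : EuclideanSpace ℝ (Fin n)) 1) ≠ ⊤ :=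
    ENNReal.mul_ne_top (by simp) measure_ball_lt_top.ne
  have htail := tendsto_ofReal_mul_kernel_tail hR0 hc (volume E) hbdd.measure_lt_top.ne
  have hnear : Tendsto (fun s : ℝ => ENNReal.ofReal s *
      (ENNReal.ofReal R * interaction (1 / 4) E Eᶜ)) (𝓝[>] 0) (𝓝 0) := by
    have h1 : Tendsto (fun s : ℝ => ENNReal.ofReal s) (𝓝[>] 0) (𝓝 0) := by
      simpa using ENNReal.tendsto_ofReal (tendsto_id.mono_left nhdsWithin_le_nhds :
        Tendsto (id : ℝ → ℝ) (𝓝[>] 0) (𝓝 0))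
    simpa using ENNReal.Tendsto.mul_const h1 (Or.inr (ENNReal.mul_ne_top ENNReal.ofReal_ne_top
      (hsmooth.interaction_quarter_lt_top hn1 hbdd).ne))
  have hsum := hnear.add htail
  rw [zero_add] at hsum
  have hs : ∀ᶠ s : ℝ in 𝓝[>] 0, s ∈ Ioo (0 : ℝ) (1 / 4) := Ioo_mem_nhdsGT (by norm_num)
  -- Squeeze: the two bounds differ only by the near term, which vanishes in the limit.
  refine tendsto_of_tendsto_of_tendsto_of_le_of_le' htail hsum ?_ ?_
  · filter_upwards [hs] with s hs
    exact mul_le_mul_right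
      (le_interaction_compl hn1 (hsmooth.nullMeasurableSet hbdd) hs.1 hR0 hER) _
  · filter_upwards [hs] with s hs
    rw [← mul_add]
    exact mul_le_mul_right (interaction_compl_le hn1 hs.1 hs.2.le hR1) _
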